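/- Let $\lambda\in(0,\tfrac12)$. There is a constant $N_\lambda$, depending only on $\lambda$, such that the following holds for all $n\ge N_\lambda$. Let $G$ be a bipartite graph with parts $X=\{x_1,\dots,x_n\}$, $Y=\{y_1,\dots,y_n\}$ in which every vertex has degree at least $(\tfrac12+\lambda)n$, let $A$ be its $n\times n$ adjacency matrix, and let $Q^A=D_\alpha A D_\beta$ ($D_\alpha,D_\beta$ diagonal) be its doubly stochastic scaling. Perfect matchings $M$ of $G$ are identified with permutations ($x_i$ is matched to $y_{M(i)}$); $\nu$ is the uniform distribution on them, and $P_{ij}=\nu(M(i)=j)$. For a permutation $\pi$ of $[n]$ and a nonnegative matrix $Q$, let $$p_{\pi,Q}(M)=\prod_{i=1}^n \frac{Q_{\pi(i),M(\pi(i))}}{\sum_{j\in N_i}Q_{\pi(i),j}},$$ where $N_i$ is the set of $j$ for which some perfect matching of $G$ contains the edges $x_{\pi(l)}y_{M(\pi(l))}$, $l<i$, and the edge $x_{\pi(i)}y_j$; this is the probability that sequential importance sampling with row order $\pi$ and weights $Q$ produces $M$. Write $j\ge_\pi k$ if $\pi(j)\ge\pi(k)$, and set $$F(Q)=-\sum_{t,k=1}^n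 P_{tk}\log Q_{tk}+\sum_{t,k=1}^n P_{tk}\,\mathbb E_\pi\log\Big(\sum_{j\ge_\pi k}Q_{tj}\Big),$$ where $\pi$ is a uniformly random permutation, terms with $P_{tk}=0$ are $0$, and $F(Q)=+\infty$ if $Q_{tk}=0$ for some $(t,k)$ with $P_{tk}>0$. Let $r_i=n\max_j Q^A_{ij}$, and let $\mathcal Q$ be the set of row-stochastic matrices $Q$ such that $Q_{ij}\le r_i/n$ for all $i,j$, and $Q_{ij}>0$ only if $Q^A_{ij}>0$. Then: 1. There is a matrix $Q^*\in\mathcal Q$ such that in each row $i$ all nonzero entries of $Q^*$, except at most one, are equal to $r_i/n$, and $$F(Q^*)\ \ge\ \mathbb E_{M\sim\nu,\ \pi}\big(-\log p_{\pi,Q^A}(M)\big),$$ where $\pi$ is a uniformly random permutation independent of $M$. 2. For every $Q\in\mathcal Q$, every row $i$ and all $j_1\ne j_2$ such that $x_iy_{j_1}$ and $x_iy_{j_2}$ are edges of $G$, put $s=Q_{ij_1}+Q_{ij_2}$. Then the $(-\infty,+\infty]$-valued function of $x\in[0,s]$, obtained by evaluating $F$ at the matrix $Q$ with the entries $Q_{ij_1},Q_{ij_2}$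 replaced by $x$ and $s-x$, is convex on $[0,s]$. -/

import Mathlib

namespace SIS

open Finset

noncomputable section

open scoped Classical in
/-- The adjacency matrix of the bipartite graph on the parts `X = Y = Fin n` whose edges are the
pairs `(x_i, y_j)` with `E i j`. -/
def adjMatrix {n : ℕ} (E : Fin n → Fin n → Prop) : Matrix (Fin n) (Fin n) ℝ :=
  Matrix.of fun i j => if E i j then 1 else 0

open scoped Classical in
/-- A bipartite graph with parts of size `n` is `lam`-dense if every vertex (on either side) has
degree at least `(1/2 + lam) n`. -/
def IsDense {n : ℕ} (lam : ℝ) (E : Fin n → Fin n → Prop) : Prop :=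
  (∀ i, (1 / 2 + lam) * (n : ℝ) ≤ (#{j | E i j} : ℝ)) ∧
  (∀ j, (1 / 2 + lam) * (n : ℝ) ≤ (#{i | E i j} : ℝ))

open scoped Classical in
/-- The set of perfect matchings; the permutation `σ` is the matching `x_i ↦ y_{σ i}`. -/
def perfectMatchings {n : ℕ} (E : Fin n → Fin n → Prop) : Finset (Equiv.Perm (Fin n)) :=
  {σ | ∀ i, E i (σ i)}

/-- The matrix `P` of matching marginals: `P i j` is the probability that the edge `(x_i, y_j)`
belongs to a uniformly random perfect matching. -/
def marginal {n : ℕ} (E : Fin n → Fin n → Prop) : Matrix (Fin n) (Fin n) ℝ :=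
  Matrix.of fun i j =>
    (#{σ ∈ perfectMatchings E | σ i = j} : ℝ) / (#(perfectMatchings E) : ℝ)

/-- `QA` is the doubly stochastic scaling `D_α A D_β` of the matrix `A`. -/
def IsScaling {n : ℕ} (A QA : Matrix (Fin n) (Fin n) ℝ) : Prop :=
  QA ∈ doublyStochastic ℝ (Fin n) ∧
    ∃ α β : Fin n → ℝ, QA = Matrix.diagonal α * A * Matrix.diagonal β

/-- When the rows are processed in the order `π 0, π 1, …` and the rows before step `i` have been
matched as in `σ`, these are the extendable neighbours of `x_{π i}`: the `j` such that some
perfect matching contains the partial matching constructed so far and the edge `(x_{π i}, y_j)`. -/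
def extendable {n : ℕ} (E : Fin n → Fin n → Prop) (π σ : Equiv.Perm (Fin n)) (i : Fin n) :
    Finset (Fin n) :=
  {j | ∃ τ ∈ perfectMatchings E, (∀ i' < i, τ (π i') = σ (π i')) ∧ τ (π i) = j}

/-- The probability `p_{π,Q}(σ)` that sequential importance sampling with row order `π` and weight
matrix `Q` generates the perfect matching `σ`: at step `i` the vertex `x_{π i}` is matched to one of
its extendable neighbours, chosen with probability proportional to row `π i` of `Q`. -/
def sisProb {n : ℕ} (E : Fin n → Fin n → Prop) (Q : Matrix (Fin n) (Fin n) ℝ)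
    (π σ : Equiv.Perm (Fin n)) : ℝ :=
  ∏ i, Q (π i) (σ (π i)) / ∑ j ∈ extendable E π σ i, Q (π i) j

/-- `E[-log p_{π,Q}(M)]` for `M` a uniformly random perfect matching and, independently, `π` a
uniformly random permutation. -/
def expectedNegLog {n : ℕ} (E : Fin n → Fin n → Prop) (Q : Matrix (Fin n) (Fin n) ℝ) : ℝ :=
  (∑ σ ∈ perfectMatchings E, (∑ π : Equiv.Perm (Fin n), -Real.log (sisProb E Q π σ)) /
    (n.factorial : ℝ)) / (#(perfectMatchings E) : ℝ)

/-- `E_π log (∑_{j ≥_π k} Q t j)` for a uniformly random permutation `π`, where `j ≥_π k` means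
`π j ≥ π k`. -/
def expectedLogTail {n : ℕ} (Q : Matrix (Fin n) (Fin n) ℝ) (t k : Fin n) : ℝ :=
  (∑ π : Equiv.Perm (Fin n), Real.log (∑ j with π k ≤ π j, Q t j)) / (n.factorial : ℝ)

open scoped Classical in
/-- The functional `-∑_e P_e log Q_e + ∑_{t,k} P_{tk} E_π log (∑_{j ≥_π k} Q_{tj})`, for a
nonnegative matrix `Q`, with values in `(-∞, +∞]`.

If `Q_e ≠ 0` whenever `P_e ≠ 0`, then every logarithm with a nonzero coefficient has a positive
argument, and the value is the displayed real number (terms with `P_e = 0` vanish).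
If `Q_{tk} = 0` for some `P_{tk} ≠ 0`, then `-P_{tk} log Q_{tk} = +∞` by the convention
`-log 0 = +∞`, and the value is `+∞`. -/
def upperBound {n : ℕ} (P Q : Matrix (Fin n) (Fin n) ℝ) : EReal :=
  if ∀ t k, P t k ≠ 0 → Q t k ≠ 0 then
    ((-(∑ t, ∑ k, P t k * Real.log (Q t k)) + ∑ t, ∑ k, P t k * expectedLogTail Q t k : ℝ) : EReal)
  else ⊤

/-- `r_i = n * max_j QA i j`. -/
def rowMax {n : ℕ} (QA : Matrix (Fin n) (Fin n) ℝ) (i : Fin n) : ℝ := (n : ℝ) * ⨆ j, QA i j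

/-- The class of row-stochastic matrices whose entries in row `i` are at most `r_i / n` and whose
nonzero entries are at positions of nonzero entries of `QA`. -/
def classQ {n : ℕ} (QA : Matrix (Fin n) (Fin n) ℝ) : Set (Matrix (Fin n) (Fin n) ℝ) :=
  {Q | Q ∈ Matrix.rowStochastic ℝ (Fin n) ∧ (∀ i j, Q i j ≤ rowMax QA i / (n : ℝ)) ∧
    ∀ i j, 0 < Q i j → 0 < QA i j}

/-- The matrix obtained from `Q` by replacing the entries `(i, j₁)` and `(i, j₂)` (where `j₁ ≠ j₂`)
by `x` and `Q i j₁ + Q i j₂ - x`, so that the row sums do not change. -/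
def exchange {n : ℕ} (Q : Matrix (Fin n) (Fin n) ℝ) (i j₁ j₂ : Fin n) (x : ℝ) :
    Matrix (Fin n) (Fin n) ℝ :=
  Matrix.of fun a b =>
    if a = i ∧ b = j₁ then x else if a = i ∧ b = j₂ then Q i j₁ + Q i j₂ - x else Q a b

/-- Convexity on a set `s` of reals of an extended-real function that does not take the value `-∞`
(with `0 * (+∞) = 0`). -/
def ConvexOnEReal (s : Set ℝ) (g : ℝ → EReal) : Prop :=
  ∀ x ∈ s, ∀ y ∈ s, ∀ θ : ℝ, 0 ≤ θ → θ ≤ 1 →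
    g (θ * x + (1 - θ) * y) ≤ (θ : EReal) * g x + ((1 - θ : ℝ) : EReal) * g y

end

end SIS

/-!
**The entropy bound.** If row `x_t` is processed in the order `π` and `M` matches it to `k`, then
its extendable neighbours are among the columns that are still unmatched, that is, those that come
at or after `k` in the column order `M ∘ π`. For fixed `M` this order is again uniformly random.
Enlarging each normalising sum of `p_{π,Q}(M)` to the sum over the unmatched columns and averaging
therefore gives `E(-log p_{π,Q}(M)) ≤ F(Q)`.

**Convexity of `F`.** Let `x` be the entry at `j₁` and `s - x` the entry at `j₂`. A tail sum that
contains both or neither of these is constant in `x`. If it contains only `j₁`, it is `x + R`, and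
`log (x + R) - w log x` is convex on `(0, s)` for `w = (s / (s + R)) ^ 2`. So `F` is convex as soon
as `∑ k, P i k * E w ≤ P i j₁`, and symmetrically for `j₂`. For `k = j₁` the tail omits `j₂` with
probability `1/2`, which costs at most `P i j₁ / 2`. For `k ≠ j₁` the entries of row `i` are at most
`C / n`, hence a positive proportion of them is at least `1 / (2 n)`. When `r` of these have rank
above `k` we get `w = O(1 / r ^ 2)`, while `j₁` has rank above `k` with probability about `r / n`.
Thus `E w = O(n⁻¹ ∑ r ≤ n, 1 / (r n)) = o(1 / n)`, which is less than `P i j₁ / 2` for large `n`.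

**Estimates from density.** Scaling gives `Q^A i j * Q^A l k ≤ Q^A l j * Q^A i k` for neighbours `l`
of `y_j` and `k` of `x_i`. Sum over the rectangle of these `l` and `k`: its entries `Q^A l k` add up
to at least its two side lengths minus `n`, hence to at least `2 λ n`, and this yields
`Q^A i j ≤ 1 / (2 λ n)`. For an edge `x_i y_j`, a perfect matching avoiding it can be rotated along
an alternating cycle of length at most `6` into one that contains it in at least `λ n` ways, and
every matching is reached at most `n ^ 2` times, so `P i j ≥ λ / (2 n)`.

**Extremal matrices.** Along an exchange of two entries of a row, both strictly between `0` and
`r_i / n`, the convex function `F` does not decrease in one of the two directions, until one of the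
entries is `0` or `r_i / n`. Among the matrices in `𝒬` at which `F` is at least `F(Q^A)`, one with
the fewest such entries has at most one in each row.
-/

namespace SIS

open Finset Equiv

open scoped BigOperators

/-! ### Ranks in a uniformly random permutation -/

lemma sum_card_filter_lt {α β M : Type*} [LinearOrder β] [AddCommMonoid M] {f : α → β}
    (hf : f.Injective) (s : Finset α) (h : ℕ → M) :
    ∑ a ∈ s, h #{b ∈ s | f a < f b} = ∑ r ∈ range #s, h r := by
  classical
  induction s using induction_on_min_value f with
  | empty => simp
  | insert a s ha hmin ih =>
    have hlt : ∀ b ∈ s, f a < f b := fun b hb =>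
      (hmin b hb).lt_of_ne (hf.ne (ne_of_mem_of_not_mem hb ha).symm)
    have hrest : ∑ b ∈ s, h #{c ∈ insert a s | f b < f c} = ∑ b ∈ s, h #{c ∈ s | f b < f c} :=
      sum_congr rfl fun b hb => by rw [filter_insert, if_neg (hlt b hb).not_gt]
    rw [sum_insert ha, card_insert_of_notMem ha, sum_range_succ, hrest, ih, add_comm,
      filter_insert, if_neg (lt_irrefl _), filter_true_of_mem hlt]

lemma card_filter_swap {α : Type*} [DecidableEq α] {s : Finset α} {a b : α} (ha : a ∈ s)
    (hb : b ∈ s) (p : α → Prop) [DecidablePred p] :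
    #{j ∈ s | p (swap a b j)} = #{j ∈ s | p j} := by
  have hfix : {j | swap a b j ≠ j} ⊆ s := by
    intro j hj
    contrapose! hj
    simpa using swap_apply_of_ne_of_ne (ne_of_mem_of_not_mem ha hj).symm
      (ne_of_mem_of_not_mem hb hj).symm
  simp only [card_filter]
  exact Perm.sum_comp _ _ (fun j => if p j then 1 else 0) hfix

section RandomPermutation

variable {α : Type*} [Fintype α] [LinearOrder α] {s : Finset α}

lemma expect_perm_card_filter_lt {M : Type*} [AddCommMonoid M] [Module ℚ≥0 M] {k : α}
    (hk : k ∈ s) (h : ℕ → M) :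
    𝔼 π : Perm α, h #{j ∈ s | π k < π j} = 𝔼 r ∈ range #s, h r := by
  have hsymm : ∀ a ∈ s, 𝔼 π : Perm α, h #{j ∈ s | π a < π j} =
      𝔼 π : Perm α, h #{j ∈ s | π k < π j} := fun a ha =>
    Fintype.expect_equiv (Equiv.mulRight (swap a k)) _ _ fun π => by
      simp [card_filter_swap ha hk fun j => π a < π j]
  calc 𝔼 π : Perm α, h #{j ∈ s | π k < π j}
      = 𝔼 a ∈ s, 𝔼 π : Perm α, h #{j ∈ s | π a < π j} := by
        rw [expect_congr rfl hsymm, expect_const ⟨k, hk⟩]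
    _ = 𝔼 _π : Perm α, 𝔼 r ∈ range #s, h r := by
        rw [expect_comm]
        refine expect_congr rfl fun π _ => ?_
        rw [expect, expect, sum_card_filter_lt π.injective, card_range]
    _ = 𝔼 r ∈ range #s, h r := expect_const univ_nonempty _

lemma expect_perm_ite_lt {K : Type*} [Field K] [CharZero K] {i j : α} (hij : i ≠ j) :
    𝔼 π : Perm α, (if π i < π j then 1 else 0 : K) = 1 / 2 := by
  have hcard : ∀ π : Perm α, #{l ∈ {i, j} | π i < π l} = if π i < π j then 1 else 0 := by
    intro π
    rw [filter_insert, if_neg (lt_irrefl _), filter_singleton]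
    split_ifs <;> simp
  have h := expect_perm_card_filter_lt (mem_insert_self i {j}) (Nat.cast : ℕ → K)
  rw [card_pair hij] at h
  simpa [hcard, expect_eq_sum_div_card, sum_range_succ] using h

lemma expect_perm_ite_lt_card_filter_lt {K : Type*} [Field K] [CharZero K] {j k : α}
    (hj : j ∈ s) (hk : k ∉ s) (g : ℕ → K) :
    𝔼 π : Perm α, (if π k < π j then g #{l ∈ s | π k < π l} else 0) =
      (𝔼 r ∈ range (#s + 1), r * g r) / #s := by
  have hs : (#s : K) ≠ 0 := Nat.cast_ne_zero.2 (card_ne_zero_of_mem hj)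
  have hsymm : ∀ a ∈ s, 𝔼 π : Perm α, (if π k < π a then g #{l ∈ s | π k < π l} else 0) =
      𝔼 π : Perm α, (if π k < π j then g #{l ∈ s | π k < π l} else 0) := fun a ha =>
    Fintype.expect_equiv (Equiv.mulRight (swap a j)) _ _ fun π => by
      simp [card_filter_swap ha hj fun l => π k < π l,
        swap_apply_of_ne_of_ne (ne_of_mem_of_not_mem ha hk).symm (ne_of_mem_of_not_mem hj hk).symm]
  have hsum : ∀ π : Perm α, ∑ a ∈ s, (if π k < π a then g #{l ∈ s | π k < π l} else 0) =
      #{l ∈ insert k s | π k < π l} * g #{l ∈ insert k s | π k < π l} := by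
    intro π
    rw [filter_insert, if_neg (lt_irrefl _), ← sum_filter, sum_const, nsmul_eq_mul]
  rw [eq_div_iff hs, mul_comm, ← nsmul_eq_mul, ← sum_const, ← sum_congr rfl hsymm,
    ← expect_sum_comm, expect_congr rfl fun π _ => hsum π,
    expect_perm_card_filter_lt (mem_insert_self k s) (fun r => r * g r), card_insert_of_notMem hk]

end RandomPermutation

/-! ### Convexity of combinations of logarithms -/

section Convexity

variable {E : Type*} [AddCommMonoid E] [Module ℝ E] {D : Set E}

lemma convexOn_sum {ι : Type*} (hD : Convex ℝ D) {s : Finset ι} {f : ι → E → ℝ}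
    (hf : ∀ i ∈ s, ConvexOn ℝ D (f i)) : ConvexOn ℝ D fun x => ∑ i ∈ s, f i x := by
  classical
  induction s using Finset.induction_on with
  | empty => simpa only [sum_empty] using convexOn_const 0 hD
  | insert a s ha ih =>
    simp only [sum_insert ha]
    exact (hf a (mem_insert_self a s)).add (ih fun i hi => hf i (mem_insert_of_mem hi))

lemma convexOn_expect {ι : Type*} (hD : Convex ℝ D) {s : Finset ι} {f : ι → E → ℝ}
    (hf : ∀ i ∈ s, ConvexOn ℝ D (f i)) : ConvexOn ℝ D fun x => 𝔼 i ∈ s, f i x := by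
  simp only [expect_eq_sum_div_card, div_eq_inv_mul]
  exact (convexOn_sum hD hf).smul (by positivity)

lemma convexOn_Ioo_comp_sub {s : ℝ} {f : ℝ → ℝ} (hf : ConvexOn ℝ (Set.Ioo 0 s) f) :
    ConvexOn ℝ (Set.Ioo 0 s) fun x => f (s - x) := by
  have h := hf.comp_affineMap (AffineMap.const ℝ ℝ s - AffineMap.id ℝ ℝ)
  have hpre : (AffineMap.const ℝ ℝ s - AffineMap.id ℝ ℝ) ⁻¹' Set.Ioo 0 s = Set.Ioo 0 s := by
    ext x
    simp [and_comm]
  rwa [hpre] at h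

lemma convexOn_neg_log (s : ℝ) : ConvexOn ℝ (Set.Ioo 0 s) fun x => -Real.log x :=
  strictConcaveOn_log_Ioi.concaveOn.neg.subset Set.Ioo_subset_Ioi_self (convex_Ioo 0 s)

lemma convexOn_log_add_sub_mul_log {s R c : ℝ} (hR : 0 ≤ R) (hc : (s / (s + R)) ^ 2 ≤ c) :
    ConvexOn ℝ (Set.Ioo 0 s) fun x => Real.log (x + R) - c * Real.log x := by
  have hderiv : ∀ x ∈ Set.Ioo 0 s, HasDerivAt (fun x => Real.log (x + R) - c * Real.log x)
      (1 / (x + R) - c * x⁻¹) x := by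
    rintro x ⟨hx, -⟩
    exact (((hasDerivAt_id' x).add_const R).log (by positivity)).sub
      ((Real.hasDerivAt_log hx.ne').const_mul c)
  have hderiv₂ : ∀ x ∈ Set.Ioo 0 s, HasDerivAt (fun x => 1 / (x + R) - c * x⁻¹)
      (-1 / (x + R) ^ 2 - c * -(x ^ 2)⁻¹) x := by
    rintro x ⟨hx, -⟩
    simpa only [one_div] using (((hasDerivAt_id' x).add_const R).fun_inv (by positivity)).fun_sub
      ((hasDerivAt_inv hx.ne').const_mul c)
  have hnonneg : ∀ x ∈ Set.Ioo 0 s, 0 ≤ -1 / (x + R) ^ 2 - c * -(x ^ 2)⁻¹ := by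
    rintro x ⟨hx, hxs⟩
    have hs : 0 < s := hx.trans hxs
    have hratio : x / (x + R) ≤ s / (s + R) := by
      rw [div_le_div_iff₀ (by positivity) (by positivity)]
      linarith [mul_le_mul_of_nonneg_right hxs.le hR]
    have hc' : (x / (x + R)) ^ 2 ≤ c := (pow_le_pow_left₀ (by positivity) hratio 2).trans hc
    calc 0 ≤ (c - (x / (x + R)) ^ 2) / x ^ 2 := div_nonneg (sub_nonneg.2 hc') (sq_nonneg x)
      _ = -1 / (x + R) ^ 2 - c * -(x ^ 2)⁻¹ := by
        field_simp
        ring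
  exact convexOn_of_hasDerivWithinAt2_nonneg (convex_Ioo 0 s)
    (fun x hx => (hderiv x hx).continuousAt.continuousWithinAt)
    (fun x hx => (hderiv x (interior_subset hx)).hasDerivWithinAt)
    (fun x hx => (hderiv₂ x (interior_subset hx)).hasDerivWithinAt)
    fun x hx => hnonneg x (interior_subset hx)

end Convexity

/-! ### The row functional and its convexity along mass transfers -/

section Transfer

variable {α : Type*} [DecidableEq α]

/-- The vector `q` after moving mass between `j₁` and `j₂` so that the entry at `j₁` is `x`. -/
def transfer (q : α → ℝ) (j₁ j₂ : α) (x : ℝ) : α → ℝ :=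
  q + Pi.single j₁ (x - q j₁) - Pi.single j₂ (x - q j₁)

variable {q : α → ℝ} {j₁ j₂ k : α}

@[simp] lemma transfer_apply_left (hj : j₁ ≠ j₂) (x : ℝ) : transfer q j₁ j₂ x j₁ = x := by
  simp [transfer, hj]

@[simp] lemma transfer_apply_right (hj : j₁ ≠ j₂) (x : ℝ) :
    transfer q j₁ j₂ x j₂ = q j₁ + q j₂ - x := by
  simp only [transfer, Pi.add_apply, Pi.sub_apply, Pi.single_eq_same, Pi.single_eq_of_ne' hj]
  ring

lemma transfer_apply_of_ne (h₁ : k ≠ j₁) (h₂ : k ≠ j₂) (x : ℝ) : transfer q j₁ j₂ x k = q k := by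
  simp [transfer, h₁, h₂]

lemma transfer_self (q : α → ℝ) (j₁ j₂ : α) : transfer q j₁ j₂ (q j₁) = q := by
  simp [transfer]

lemma transfer_swap (q : α → ℝ) (j₁ j₂ : α) (x : ℝ) :
    transfer q j₂ j₁ (q j₁ + q j₂ - x) = transfer q j₁ j₂ x := by
  have h : q j₁ + q j₂ - x - q j₂ = -(x - q j₁) := by ring
  rw [transfer, transfer, h, Pi.single_neg, Pi.single_neg]
  abel

lemma sum_transfer [Fintype α] (q : α → ℝ) (j₁ j₂ : α) (x : ℝ) :
    ∑ j, transfer q j₁ j₂ x j = ∑ j, q j := by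
  simp [transfer, sum_add_distrib]

lemma sum_mul_neg_log_transfer [Fintype α] (p q : α → ℝ) (hj : j₁ ≠ j₂) (x : ℝ) :
    ∑ k, p k * -Real.log (transfer q j₁ j₂ x k) =
      p j₁ * -Real.log x + p j₂ * -Real.log (q j₁ + q j₂ - x) +
        ∑ k ∈ {j₁, j₂}ᶜ, p k * -Real.log (q k) := by
  rw [← sum_add_sum_compl {j₁, j₂}, sum_pair hj, transfer_apply_left hj, transfer_apply_right hj]
  congr 1
  refine sum_congr rfl fun k hk => ?_
  rw [mem_compl, mem_insert, mem_singleton, not_or] at hk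
  rw [transfer_apply_of_ne hk.1 hk.2]

end Transfer

noncomputable section RowBound

variable {α : Type*} [Fintype α] [LinearOrder α]

/-- The total weight of the indices that `π` ranks at least as high as `k`. If a row with entries
`q` is processed at the time at which only these columns are available, this is the normalising
constant of the importance sampling distribution. -/
def tailSum (q : α → ℝ) (π : Perm α) (k : α) : ℝ := ∑ j with π k ≤ π j, q j

/-- The contribution to the functional `F` of a row with entries `q` which is matched to `k`: an
upper bound for the expected surprisal `-log` of the probability of that choice. -/
def surprisalBound (q : α → ℝ) (k : α) : ℝ := -Real.log (q k) + 𝔼 π, Real.log (tailSum q π k)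

/-- The contribution to the functional `F` of a row with entries `q` and matching marginals `p`. -/
def rowBound (p q : α → ℝ) : ℝ := ∑ k, p k * surprisalBound q k

/-- The least multiple of `-log x` whose addition makes `log (tailSum (transfer q j₁ j₂ x) π k)`
convex in `x` when the tail contains `j₁` but not `j₂`. -/
def tailWeight (q : α → ℝ) (j₁ j₂ : α) (π : Perm α) (k : α) : ℝ :=
  if π k ≤ π j₁ ∧ π j₂ < π k then ((q j₁ + q j₂) / (q j₂ + tailSum q π k)) ^ 2 else 0

variable {p q : α → ℝ} {j₁ j₂ k : α}

lemma tailSum_transfer (q : α → ℝ) (j₁ j₂ : α) (x : ℝ) (π : Perm α) (k : α) :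
    tailSum (transfer q j₁ j₂ x) π k = tailSum q π k +
      (if π k ≤ π j₁ then x - q j₁ else 0) - if π k ≤ π j₂ then x - q j₁ else 0 := by
  simp [tailSum, transfer, sum_add_distrib, sum_pi_single']

lemma convexOn_log_tailSum_transfer_of_lt (hq : 0 ≤ q) {π : Perm α} (h₁ : π k ≤ π j₁)
    (h₂ : π j₂ < π k) :
    ConvexOn ℝ (Set.Ioo 0 (q j₁ + q j₂)) fun x => Real.log (tailSum (transfer q j₁ j₂ x) π k) -
      tailWeight q j₁ j₂ π k * Real.log x := by
  have hle : q j₁ ≤ tailSum q π k := single_le_sum (fun j _ => hq j) (by simpa using h₁)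
  have htail : ∀ x, tailSum (transfer q j₁ j₂ x) π k = x + (tailSum q π k - q j₁) := by
    intro x
    rw [tailSum_transfer, if_pos h₁, if_neg h₂.not_ge]
    ring
  have hweight : ((q j₁ + q j₂) / (q j₁ + q j₂ + (tailSum q π k - q j₁))) ^ 2 =
      tailWeight q j₁ j₂ π k := by
    rw [tailWeight, if_pos ⟨h₁, h₂⟩]
    ring
  simpa only [htail] using convexOn_log_add_sub_mul_log (sub_nonneg.2 hle) hweight.le

lemma convexOn_log_tailSum_transfer (hq : 0 ≤ q) (π : Perm α) (k : α) :
    ConvexOn ℝ (Set.Ioo 0 (q j₁ + q j₂)) fun x => Real.log (tailSum (transfer q j₁ j₂ x) π k) -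
      tailWeight q j₁ j₂ π k * Real.log x -
      tailWeight q j₂ j₁ π k * Real.log (q j₁ + q j₂ - x) := by
  have hconst : ∀ c : ℝ, ConvexOn ℝ (Set.Ioo 0 (q j₁ + q j₂)) fun _ => c := fun c =>
    convexOn_const c (convex_Ioo _ _)
  rcases le_or_gt (π k) (π j₁) with h₁ | h₁ <;> rcases le_or_gt (π k) (π j₂) with h₂ | h₂
  · simpa [tailSum_transfer, tailWeight, h₁, h₂, h₁.not_gt, h₂.not_gt] using hconst _
  · simpa [tailWeight, h₁, h₂, h₁.not_gt] using convexOn_log_tailSum_transfer_of_lt hq h₁ h₂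
  · have h := convexOn_log_tailSum_transfer_of_lt hq h₂ h₁
    rw [add_comm] at h
    simpa [transfer_swap, tailWeight, h₁, h₂, h₂.not_gt] using convexOn_Ioo_comp_sub h
  · simpa [tailSum_transfer, tailWeight, h₁.not_ge, h₂.not_ge] using hconst _

lemma convexOn_rowBound_transfer (hp : 0 ≤ p) (hq : 0 ≤ q) (hj : j₁ ≠ j₂)
    (h₁ : ∑ k, p k * 𝔼 π, tailWeight q j₁ j₂ π k ≤ p j₁)
    (h₂ : ∑ k, p k * 𝔼 π, tailWeight q j₂ j₁ π k ≤ p j₂) :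
    ConvexOn ℝ (Set.Ioo 0 (q j₁ + q j₂)) fun x => rowBound p (transfer q j₁ j₂ x) := by
  set s := q j₁ + q j₂
  set g : Perm α → α → ℝ → ℝ := fun π k x => Real.log (tailSum (transfer q j₁ j₂ x) π k) -
    tailWeight q j₁ j₂ π k * Real.log x - tailWeight q j₂ j₁ π k * Real.log (s - x) with hg
  have hlog := convexOn_neg_log s
  have htail : ConvexOn ℝ (Set.Ioo 0 s) fun x => ∑ k, p k * 𝔼 π, g π k x :=
    convexOn_sum (convex_Ioo 0 s) fun k _ => (convexOn_expect (convex_Ioo 0 s) fun π _ =>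
      convexOn_log_tailSum_transfer hq π k).smul (hp k)
  have hdecomp : ∀ x, rowBound p (transfer q j₁ j₂ x) =
      (p j₁ - ∑ k, p k * 𝔼 π, tailWeight q j₁ j₂ π k) * -Real.log x +
      (p j₂ - ∑ k, p k * 𝔼 π, tailWeight q j₂ j₁ π k) * -Real.log (s - x) +
      ∑ k, p k * 𝔼 π, g π k x + ∑ k ∈ {j₁, j₂}ᶜ, p k * -Real.log (q k) := by
    intro x
    simp only [rowBound, surprisalBound, mul_add, sum_add_distrib,
      sum_mul_neg_log_transfer p q hj, hg, expect_sub_distrib, ← expect_mul, mul_sub,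
      sum_sub_distrib, ← mul_assoc, ← sum_mul]
    ring
  simp only [hdecomp]
  exact (((hlog.smul (sub_nonneg.2 h₁)).add
    ((convexOn_Ioo_comp_sub hlog).smul (sub_nonneg.2 h₂))).add htail).add_const _

end RowBound

/-! ### Estimates for the weights -/

section WeightEstimates

open Filter

variable {α : Type*} [Fintype α]

lemma sum_le_card_filter_mul_add {q : α → ℝ} {a b : ℝ} (ha : 0 ≤ a) (hb : ∀ j, q j ≤ b) :
    ∑ j, q j ≤ #{j | a ≤ q j} * b + Fintype.card α * a := by
  rw [← sum_filter_add_sum_filter_not univ (fun j => a ≤ q j)]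
  refine add_le_add ?_ ?_
  · simpa only [nsmul_eq_mul] using sum_le_card_nsmul _ _ b fun j _ => hb j
  · calc ∑ j with ¬a ≤ q j, q j ≤ #{j | ¬a ≤ q j} * a := by
          simpa only [nsmul_eq_mul] using
            sum_le_card_nsmul _ _ a fun j hj => (not_le.1 (mem_filter.1 hj).2).le
      _ ≤ Fintype.card α * a := by gcongr; exact card_le_univ _

lemma exists_finset_large_entries {q : α → ℝ} {j₁ k : α} (hsum : ∑ j, q j = 1)
    {C : ℝ} (hC : 0 < C) (hle : ∀ j, q j ≤ C / Fintype.card α)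
    (hcard : 8 * C ≤ Fintype.card α) (hk : k ≠ j₁) :
    ∃ s : Finset α, j₁ ∈ s ∧ k ∉ s ∧ (∀ j ∈ s, j ≠ j₁ → 1 / (2 * Fintype.card α) ≤ q j) ∧
      Fintype.card α / (4 * C) ≤ #s := by
  classical
  have hn : (0 : ℝ) < Fintype.card α := by linarith
  set n := (Fintype.card α : ℝ)
  refine ⟨insert j₁ (({j | 1 / (2 * n) ≤ q j} : Finset α).erase k), mem_insert_self _ _, by
    simp [hk], fun j hj hj₁ => (mem_filter.1 (mem_of_mem_erase (mem_of_mem_insert_of_ne hj hj₁))).2,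
    ?_⟩
  have hlarge : n / (2 * C) ≤ #{j | 1 / (2 * n) ≤ q j} := by
    have h := sum_le_card_filter_mul_add (a := 1 / (2 * n)) (by positivity) hle
    rw [hsum] at h
    change 1 ≤ (#{j | 1 / (2 * n) ≤ q j} : ℝ) * (C / n) + n * (1 / (2 * n)) at h
    field_simp at h ⊢
    linarith
  have herase : (#{j | 1 / (2 * n) ≤ q j} : ℝ) ≤
      #(insert j₁ (({j | 1 / (2 * n) ≤ q j} : Finset α).erase k)) + 1 := by
    exact_mod_cast (Nat.sub_le_iff_le_add.1 pred_card_le_card_erase).trans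
      (Nat.add_le_add_right (card_le_card (subset_insert _ _)) 1)
  have hhalf : n / (4 * C) + n / (4 * C) = n / (2 * C) := by
    field_simp
    norm_num
  have htwo : 2 ≤ n / (4 * C) := by
    rw [le_div_iff₀ (by positivity)]
    linarith
  linarith

variable [LinearOrder α] {p q : α → ℝ} {j₁ j₂ k : α}

lemma tailWeight_le_ite (hq : 0 ≤ q) (π : Perm α) :
    tailWeight q j₁ j₂ π k ≤ if π j₂ < π k then 1 else 0 := by
  rw [tailWeight]
  split_ifs with h h₂ h₂
  · have hle : q j₁ ≤ tailSum q π k := single_le_sum (fun j _ => hq j) (by simpa using h.1)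
    have h₁ : 0 ≤ q j₁ := hq j₁
    have h₂ : 0 ≤ q j₂ := hq j₂
    exact pow_le_one₀ (div_nonneg (by linarith) (by linarith))
      (div_le_one_of_le₀ (by linarith) (by linarith))
  · exact absurd h.2 h₂
  · exact zero_le_one
  · exact le_rfl

lemma expect_tailWeight_self_le (hq : 0 ≤ q) (hj : j₁ ≠ j₂) :
    𝔼 π, tailWeight q j₁ j₂ π j₁ ≤ 1 / 2 :=
  (expect_le_expect fun π _ => tailWeight_le_ite hq π).trans (expect_perm_ite_lt hj.symm).le

lemma add_mul_card_sub_one_le_tailSum (hq : 0 ≤ q) {s : Finset α} {a : ℝ} (h₁ : j₁ ∈ s)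
    (ha : ∀ j ∈ s, j ≠ j₁ → a ≤ q j) {π : Perm α} (hπ : π k < π j₁) :
    q j₁ + a * (#{j ∈ s | π k < π j} - 1) ≤ tailSum q π k := by
  have hmem : j₁ ∈ ({j ∈ s | π k < π j} : Finset α) := mem_filter.2 ⟨h₁, hπ⟩
  calc q j₁ + a * (#{j ∈ s | π k < π j} - 1)
      = q j₁ + #(({j ∈ s | π k < π j} : Finset α).erase j₁) • a := by
        rw [nsmul_eq_mul, cast_card_erase_of_mem hmem, mul_comm]
    _ ≤ q j₁ + ∑ j ∈ ({j ∈ s | π k < π j} : Finset α).erase j₁, q j := by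
        gcongr
        exact card_nsmul_le_sum _ _ _ fun j hj =>
          ha j (mem_filter.1 (mem_of_mem_erase hj)).1 (ne_of_mem_erase hj)
    _ = ∑ j ∈ s with π k < π j, q j := add_sum_erase _ _ hmem
    _ ≤ tailSum q π k := sum_le_sum_of_subset_of_nonneg
        (fun j hj => by simpa using (mem_filter.1 hj).2.le) fun j _ _ => hq j

lemma tailWeight_le_sq_div_card (hq : 0 ≤ q) {s : Finset α} {a c : ℝ} (h₁ : j₁ ∈ s) (hk : k ∉ s)
    (ha₀ : 0 ≤ a) (ha : ∀ j ∈ s, j ≠ j₁ → a ≤ q j) (hc : 1 ≤ c) (hca : q j₁ + q j₂ ≤ c * a)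
    (π : Perm α) :
    tailWeight q j₁ j₂ π k ≤ if π k < π j₁ then (c / #{j ∈ s | π k < π j}) ^ 2 else 0 := by
  rw [tailWeight]
  split_ifs with h hlt hlt
  · have htail := add_mul_card_sub_one_le_tailSum hq h₁ ha hlt
    have hcard : 1 ≤ (#{j ∈ s | π k < π j} : ℝ) := by
      exact_mod_cast card_pos.2 ⟨j₁, mem_filter.2 ⟨h₁, hlt⟩⟩
    set r := (#{j ∈ s | π k < π j} : ℝ)
    have hs : 0 ≤ q j₁ + q j₂ := add_nonneg (hq j₁) (hq j₂)
    have htail₀ : 0 ≤ q j₂ + tailSum q π k := by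
      linarith [mul_nonneg ha₀ (sub_nonneg.2 hcard)]
    refine pow_le_pow_left₀ (div_nonneg hs htail₀) (div_le_of_le_mul₀ htail₀ (by positivity) ?_) 2
    rw [div_mul_eq_mul_div, le_div_iff₀ (by positivity)]
    calc (q j₁ + q j₂) * r = 1 * (q j₁ + q j₂) + (q j₁ + q j₂) * (r - 1) := by ring
      _ ≤ c * (q j₁ + q j₂) + c * a * (r - 1) := by
          gcongr
      _ = c * (q j₂ + (q j₁ + a * (r - 1))) := by ring
      _ ≤ c * (q j₂ + tailSum q π k) := by gcongr
  · exact absurd (π.injective (h.1.antisymm (not_lt.1 hlt))) (ne_of_mem_of_not_mem h₁ hk).symm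
  · positivity
  · exact le_rfl

lemma expect_tailWeight_le_div_card (hq : 0 ≤ q) {s : Finset α} {a c : ℝ} (h₁ : j₁ ∈ s)
    (hk : k ∉ s) (ha₀ : 0 ≤ a) (ha : ∀ j ∈ s, j ≠ j₁ → a ≤ q j) (hc : 1 ≤ c)
    (hca : q j₁ + q j₂ ≤ c * a) :
    𝔼 π, tailWeight q j₁ j₂ π k ≤ c ^ 2 * (𝔼 r ∈ range (#s + 1), (r : ℝ)⁻¹) / #s := by
  have hg : ∀ r : ℕ, (r : ℝ) * (c / r) ^ 2 = c ^ 2 * (r : ℝ)⁻¹ := by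
    intro r
    rcases eq_or_ne (r : ℝ) 0 with hr | hr
    · simp [hr]
    · field_simp
  calc 𝔼 π, tailWeight q j₁ j₂ π k
      ≤ 𝔼 π : Perm α, (if π k < π j₁ then (c / #{j ∈ s | π k < π j}) ^ 2 else 0) :=
        expect_le_expect fun π _ => tailWeight_le_sq_div_card hq h₁ hk ha₀ ha hc hca π
    _ = c ^ 2 * (𝔼 r ∈ range (#s + 1), (r : ℝ)⁻¹) / #s := by
        simp only [expect_perm_ite_lt_card_filter_lt h₁ hk fun r : ℕ => (c / r) ^ 2, hg, mul_expect]

lemma expect_tailWeight_le (hq : 0 ≤ q) (hsum : ∑ j, q j = 1) {C δ : ℝ} (hC : 1 ≤ C)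
    (hle : ∀ j, q j ≤ C / Fintype.card α) (hcard : 8 * C ≤ Fintype.card α)
    (hδ : ∀ m : ℕ, Fintype.card α / (4 * C) ≤ m → 𝔼 r ∈ range (m + 1), (r : ℝ)⁻¹ ≤ δ)
    (hk : k ≠ j₁) :
    𝔼 π, tailWeight q j₁ j₂ π k ≤ 64 * C ^ 3 * δ / Fintype.card α := by
  obtain ⟨s, h₁, hks, hs, hs_card⟩ :=
    exists_finset_large_entries hsum (by linarith) hle hcard hk
  have hn : (0 : ℝ) < Fintype.card α := by linarith
  have hpair : q j₁ + q j₂ ≤ 4 * C * (1 / (2 * Fintype.card α)) := by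
    calc q j₁ + q j₂ ≤ C / Fintype.card α + C / Fintype.card α := add_le_add (hle j₁) (hle j₂)
      _ = 4 * C * (1 / (2 * Fintype.card α)) := by
        field_simp
        norm_num
  have hδ₀ : 0 ≤ δ := (expect_nonneg fun r _ => by positivity).trans (hδ #s hs_card)
  calc 𝔼 π, tailWeight q j₁ j₂ π k
      ≤ (4 * C) ^ 2 * (𝔼 r ∈ range (#s + 1), (r : ℝ)⁻¹) / #s :=
        expect_tailWeight_le_div_card hq h₁ hks (by positivity) hs (by linarith) hpair
    _ ≤ (4 * C) ^ 2 * δ / (Fintype.card α / (4 * C)) := by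
        gcongr
        exact hδ #s hs_card
    _ = 64 * C ^ 3 * δ / Fintype.card α := by
        field_simp
        ring

lemma sum_mul_expect_tailWeight_le (hp : 0 ≤ p) (hp_sum : ∑ k, p k = 1) (hq : 0 ≤ q)
    (hj : j₁ ≠ j₂) {ε : ℝ} (hε : ∀ k, k ≠ j₁ → 𝔼 π, tailWeight q j₁ j₂ π k ≤ ε)
    (hp₁ : 2 * ε ≤ p j₁) : ∑ k, p k * 𝔼 π, tailWeight q j₁ j₂ π k ≤ p j₁ := by
  have hε₀ : 0 ≤ ε := (expect_nonneg fun π _ => by rw [tailWeight]; positivity).trans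
    (hε j₂ hj.symm)
  have hrest : ∑ k ∈ univ.erase j₁, p k ≤ 1 :=
    hp_sum ▸ sum_le_sum_of_subset_of_nonneg (erase_subset _ _) fun k _ _ => hp k
  rw [← add_sum_erase univ _ (mem_univ j₁)]
  calc p j₁ * 𝔼 π, tailWeight q j₁ j₂ π j₁ +
        ∑ k ∈ univ.erase j₁, p k * 𝔼 π, tailWeight q j₁ j₂ π k
      ≤ p j₁ * (1 / 2) + ∑ k ∈ univ.erase j₁, p k * ε := by
        gcongr with k hk
        · exact hp j₁
        · exact expect_tailWeight_self_le hq hj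
        · exact hp k
        · exact hε k (ne_of_mem_erase hk)
    _ ≤ p j₁ * (1 / 2) + 1 * ε := by
        rw [← sum_mul]
        gcongr
    _ ≤ p j₁ := by linarith

lemma eventually_expect_range_inv_le {ε : ℝ} (hε : 0 < ε) :
    ∀ᶠ m : ℕ in atTop, 𝔼 r ∈ range (m + 1), (r : ℝ)⁻¹ ≤ ε := by
  have h := (tendsto_inv_atTop_nhds_zero_nat (𝕜 := ℝ)).cesaro.comp (tendsto_add_atTop_nat 1)
  filter_upwards [h.eventually_le_const hε] with m hm
  simpa [expect_eq_sum_div_card, div_eq_inv_mul] using hm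

lemma eventually_convexOn_rowBound_transfer {C c : ℝ} (hC : 1 ≤ C) (hc : 0 < c) :
    ∀ᶠ n : ℕ in atTop, ∀ p q : Fin n → ℝ, 0 ≤ p → ∑ k, p k = 1 → 0 ≤ q → ∑ k, q k = 1 →
      (∀ k, q k ≤ C / n) → ∀ j₁ j₂, j₁ ≠ j₂ → c / n ≤ p j₁ → c / n ≤ p j₂ →
      ConvexOn ℝ (Set.Ioo 0 (q j₁ + q j₂)) fun x => rowBound p (transfer q j₁ j₂ x) := by
  obtain ⟨m₀, hm₀⟩ := eventually_atTop.1
    (eventually_expect_range_inv_le (by positivity : 0 < c / (128 * C ^ 3)))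
  filter_upwards [tendsto_natCast_atTop_atTop.eventually_ge_atTop (8 * C),
    tendsto_natCast_atTop_atTop.eventually_ge_atTop (m₀ * (4 * C))] with n hn hnm
  intro p q hp hp_sum hq hq_sum hq_le j₁ j₂ hj hp₁ hp₂
  have hδ : ∀ m : ℕ, Fintype.card (Fin n) / (4 * C) ≤ m →
      𝔼 r ∈ range (m + 1), (r : ℝ)⁻¹ ≤ c / (128 * C ^ 3) := by
    intro m hm
    rw [Fintype.card_fin] at hm
    exact hm₀ m (Nat.cast_le.1 (((le_div_iff₀ (by positivity)).2 hnm).trans hm))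
  have hweight : ∀ i j k, k ≠ i → 𝔼 π, tailWeight q i j π k ≤ c / n / 2 := by
    intro i j k hk
    have h := expect_tailWeight_le hq hq_sum (j₁ := i) (j₂ := j) hC (by simpa using hq_le)
      (by simpa using hn) hδ hk
    rw [Fintype.card_fin] at h
    refine h.trans_eq ?_
    field_simp
    norm_num
  refine convexOn_rowBound_transfer hp hq hj
    (sum_mul_expect_tailWeight_le hp hp_sum hq hj (hweight j₁ j₂) (by linarith))
    (sum_mul_expect_tailWeight_le hp hp_sum hq hj.symm (hweight j₂ j₁) (by linarith))

end WeightEstimates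

/-! ### Doubly stochastic scalings -/

section DoublyStochastic

variable {m : Type*} [Fintype m] [DecidableEq m]

lemma card_add_card_sub_card_le_sum {R : Type*} [CommRing R] [LinearOrder R]
    [IsStrictOrderedRing R] {M : Matrix m m R} (hM : M ∈ doublyStochastic R m) (S T : Finset m) :
    (#S + #T - Fintype.card m : R) ≤ ∑ i ∈ S, ∑ j ∈ T, M i j := by
  have hcompl : ∑ i ∈ S, ∑ j ∈ Tᶜ, M i j ≤ Fintype.card m - #T := by
    calc ∑ i ∈ S, ∑ j ∈ Tᶜ, M i j = ∑ j ∈ Tᶜ, ∑ i ∈ S, M i j := sum_comm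
      _ ≤ ∑ j ∈ Tᶜ, ∑ i, M i j := sum_le_sum fun j _ => sum_le_sum_of_subset_of_nonneg
          (subset_univ S) fun i _ _ => nonneg_of_mem_doublyStochastic hM
      _ = Fintype.card m - #T := by
          simp [sum_col_of_mem_doublyStochastic hM, card_compl, Nat.cast_sub (card_le_univ T)]
  have hrow : ∑ i ∈ S, ∑ j ∈ T, M i j + ∑ i ∈ S, ∑ j ∈ Tᶜ, M i j = #S := by
    simp [← sum_add_distrib, sum_add_sum_compl, sum_row_of_mem_doublyStochastic hM]
  linarith

lemma apply_mul_card_add_card_sub_card_le_one {R : Type*} [CommRing R] [LinearOrder R]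
    [IsStrictOrderedRing R] {M : Matrix m m R} (hM : M ∈ doublyStochastic R m) {S T : Finset m}
    {i j : m} (hST : ∀ l ∈ S, ∀ k ∈ T, M i j * M l k ≤ M l j * M i k) :
    M i j * (#S + #T - Fintype.card m) ≤ 1 := by
  have hnonneg : ∀ a b, 0 ≤ M a b := fun a b => nonneg_of_mem_doublyStochastic hM
  calc M i j * (#S + #T - Fintype.card m) ≤ M i j * ∑ l ∈ S, ∑ k ∈ T, M l k :=
        mul_le_mul_of_nonneg_left (card_add_card_sub_card_le_sum hM S T) (hnonneg i j)
    _ ≤ ∑ l ∈ S, ∑ k ∈ T, M l j * M i k := by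
        simp only [mul_sum]
        exact sum_le_sum fun l hl => sum_le_sum fun k hk => hST l hl k hk
    _ = (∑ l ∈ S, M l j) * ∑ k ∈ T, M i k := (sum_mul_sum _ _ _ _).symm
    _ ≤ (∑ l, M l j) * ∑ k, M i k :=
        mul_le_mul (sum_le_univ_sum_of_nonneg fun l => hnonneg l j)
          (sum_le_univ_sum_of_nonneg fun k => hnonneg i k) (sum_nonneg fun k _ => hnonneg i k)
          (sum_nonneg fun l _ => hnonneg l j)
    _ = 1 := by
        rw [sum_col_of_mem_doublyStochastic hM, sum_row_of_mem_doublyStochastic hM, mul_one]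

lemma exists_perm_forall_pos_of_mem_doublyStochastic {R : Type*} [Field R] [LinearOrder R]
    [IsStrictOrderedRing R] {M : Matrix m m R} (hM : M ∈ doublyStochastic R m) :
    ∃ σ : Perm m, ∀ i, 0 < M i (σ i) := by
  obtain ⟨w, hw, hw_sum, rfl⟩ := exists_eq_sum_perm_of_mem_doublyStochastic hM
  obtain ⟨σ, -, hσ⟩ : ∃ σ ∈ univ, 0 < w σ := by
    apply exists_lt_of_sum_lt
    simp [hw_sum]
  refine ⟨σ, fun i => ?_⟩
  simp only [Matrix.sum_apply, Matrix.smul_apply, PEquiv.toMatrix_apply, toPEquiv_apply,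
    Option.mem_some_iff, smul_eq_mul, mul_ite, mul_one, mul_zero]
  refine sum_pos' (fun τ _ => ?_) ⟨σ, mem_univ σ, by simpa using hσ⟩
  split_ifs
  exacts [hw τ, le_rfl]

end DoublyStochastic

section Graph

variable {n : ℕ} {lam : ℝ} {E : Fin n → Fin n → Prop} {QA : Matrix (Fin n) (Fin n) ℝ}

@[simp] lemma mem_perfectMatchings {σ : Perm (Fin n)} :
    σ ∈ perfectMatchings E ↔ ∀ i, E i (σ i) := by
  simp [perfectMatchings]

namespace IsScaling

lemma apply_nonneg (h : IsScaling (adjMatrix E) QA) (i j : Fin n) : 0 ≤ QA i j :=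
  nonneg_of_mem_doublyStochastic h.1

lemma apply_eq_zero (h : IsScaling (adjMatrix E) QA) {i j : Fin n} (hij : ¬E i j) :
    QA i j = 0 := by
  obtain ⟨α, β, rfl⟩ := h.2
  simp [Matrix.mul_diagonal, Matrix.diagonal_mul, adjMatrix, hij]

lemma edge_of_apply_pos (h : IsScaling (adjMatrix E) QA) {i j : Fin n} (hij : 0 < QA i j) :
    E i j :=
  not_not.1 fun hE => hij.ne' (h.apply_eq_zero hE)

lemma apply_mul_apply_le (h : IsScaling (adjMatrix E) QA) {i j k l : Fin n} (hlj : E l j)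
    (hik : E i k) : QA i j * QA l k ≤ QA l j * QA i k := by
  by_cases hE : E i j ∧ E l k
  · obtain ⟨α, β, rfl⟩ := h.2
    simp only [Matrix.mul_diagonal, Matrix.diagonal_mul, adjMatrix, Matrix.of_apply, hE.1, hE.2,
      hlj, hik, if_true]
    exact le_of_eq (by ring)
  · have hzero : QA i j * QA l k = 0 := by
      rcases not_and_or.1 hE with hE | hE <;> simp [h.apply_eq_zero hE]
    exact hzero.trans_le (mul_nonneg (h.apply_nonneg l j) (h.apply_nonneg i k))

lemma apply_le (h : IsScaling (adjMatrix E) QA) (hE : IsDense lam E) (hlam : 0 < lam)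
    (i j : Fin n) : QA i j ≤ 1 / (2 * lam) / n := by
  classical
  have hn : (0 : ℝ) < n := Nat.cast_pos.2 i.pos
  have hcross := apply_mul_card_add_card_sub_card_le_one h.1 (S := {l | E l j}) (T := {k | E i k})
    (i := i) (j := j) (by simpa using fun l hl k hk => h.apply_mul_apply_le hl hk)
  rw [Fintype.card_fin] at hcross
  rw [div_div, le_div_iff₀ (by positivity)]
  exact (mul_le_mul_of_nonneg_left (by linarith [hE.1 i, hE.2 j]) (h.apply_nonneg i j)).trans hcross

lemma perfectMatchings_nonempty (h : IsScaling (adjMatrix E) QA) :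
    (perfectMatchings E).Nonempty := by
  obtain ⟨σ, hσ⟩ := exists_perm_forall_pos_of_mem_doublyStochastic h.1
  exact ⟨σ, mem_perfectMatchings.2 fun i => h.edge_of_apply_pos (hσ i)⟩

end IsScaling

/-! ### Marginals of a uniformly random perfect matching -/

lemma marginal_nonneg (E : Fin n → Fin n → Prop) (i j : Fin n) : 0 ≤ marginal E i j :=
  div_nonneg (Nat.cast_nonneg _) (Nat.cast_nonneg _)

lemma sum_marginal (h : (perfectMatchings E).Nonempty) (i : Fin n) : ∑ j, marginal E i j = 1 := by
  have hfiber : ∑ j, #{σ ∈ perfectMatchings E | σ i = j} = #(perfectMatchings E) :=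
    (card_eq_sum_card_fiberwise fun _ _ => mem_coe.2 (mem_univ _)).symm
  simp only [marginal, Matrix.of_apply]
  rw [← sum_div, ← Nat.cast_sum, hfiber, div_self (Nat.cast_ne_zero.2 h.card_ne_zero)]

lemma marginal_pos {σ : Perm (Fin n)} (hσ : σ ∈ perfectMatchings E) (i : Fin n) :
    0 < marginal E i (σ i) :=
  div_pos (Nat.cast_pos.2 (card_pos.2 ⟨σ, mem_filter.2 ⟨hσ, rfl⟩⟩))
    (Nat.cast_pos.2 (card_pos.2 ⟨σ, hσ⟩))

lemma expect_perfectMatchings_sum (E : Fin n → Fin n → Prop) (φ : Fin n → Fin n → ℝ) :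
    𝔼 σ ∈ perfectMatchings E, ∑ t, φ t (σ t) = ∑ t, ∑ k, marginal E t k * φ t k := by
  rw [expect_sum_comm]
  refine sum_congr rfl fun t _ => ?_
  rw [expect_eq_sum_div_card, ← sum_fiberwise (perfectMatchings E) fun σ => σ t, sum_div]
  refine sum_congr rfl fun k _ => ?_
  rw [sum_congr rfl fun σ hσ => congrArg (φ t) (mem_filter.1 hσ).2, sum_const, nsmul_eq_mul,
    mul_div_right_comm]
  rfl

lemma IsDense.le_half (hE : IsDense lam E) (hn : 0 < n) : lam ≤ 1 / 2 := by
  have hdeg : (1 / 2 + lam) * n ≤ 1 * n := by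
    rw [one_mul]
    exact (hE.1 ⟨0, hn⟩).trans (Nat.cast_le.2 (card_finset_fin_le _))
  linarith [le_of_mul_le_mul_right hdeg (Nat.cast_pos.2 hn)]

open scoped Classical in
/-- The rows `c` for which the perfect matching `σ`, after its values at `i`, `a` and `c` have been
permuted cyclically so that `i` receives `σ a`, still uses edges in the rows `a` and `c`. -/
noncomputable def rotationRows (E : Fin n → Fin n → Prop) (σ : Perm (Fin n)) (i a : Fin n) :
    Finset (Fin n) :=
  {c | c ≠ i ∧ E c (σ i) ∧ E a (σ c)}

lemma mul_swap_mul_swap_mem_perfectMatchings {σ : Perm (Fin n)} {i a c : Fin n}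
    (hσ : σ ∈ perfectMatchings E) (hi : E i (σ a)) (hia : i ≠ a) (hc : c ∈ rotationRows E σ i a) :
    σ * (swap i a * swap a c) ∈ {τ ∈ perfectMatchings E | τ i = σ a} := by
  obtain ⟨hci, hcσ, haσ⟩ : c ≠ i ∧ E c (σ i) ∧ E a (σ c) := by simpa [rotationRows] using hc
  have hval : (σ * (swap i a * swap a c)) i = σ a := by
    simp [swap_apply_of_ne_of_ne hia hci.symm]
  refine mem_filter.2 ⟨mem_perfectMatchings.2 fun t => ?_, hval⟩
  rcases eq_or_ne t i with rfl | hti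
  · rwa [hval]
  rcases eq_or_ne t c with rfl | htc
  · simpa using hcσ
  rcases eq_or_ne t a with rfl | hta
  · simpa [swap_apply_of_ne_of_ne hci htc.symm] using haσ
  · simpa [swap_apply_of_ne_of_ne hta htc, swap_apply_of_ne_of_ne hti hta]
      using mem_perfectMatchings.1 hσ t

lemma IsDense.le_card_rotationRows (hE : IsDense lam E) (hn : 1 ≤ lam * n) (σ : Perm (Fin n))
    (i a : Fin n) : lam * n ≤ #(rotationRows E σ i a) := by
  classical
  set S : Finset (Fin n) := {c | E c (σ i)}
  set T : Finset (Fin n) := {c | E a (σ c)}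
  have hS : (1 / 2 + lam) * n ≤ #S := hE.2 (σ i)
  have hT : (1 / 2 + lam) * n ≤ #T := by
    rw [← card_map σ.toEmbedding]
    convert hE.1 a using 3
    ext k
    simp [T]
  have hrows : rotationRows E σ i a = (S ∩ T).erase i := by
    ext c
    simp [rotationRows, S, T]
  have hunion : (#S + #T : ℝ) ≤ n + #(S ∩ T) := by
    have h : #(S ∪ T) ≤ n := by simpa using card_le_univ (S ∪ T)
    exact_mod_cast (card_union_add_card_inter S T).symm.le.trans (Nat.add_le_add_right h _)
  have herase : (#(S ∩ T) : ℝ) ≤ #(rotationRows E σ i a) + 1 := by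
    rw [hrows]
    exact_mod_cast Nat.sub_le_iff_le_add.1 pred_card_le_card_erase
  linarith

lemma IsDense.card_mul_le_card_mul_sq (hE : IsDense lam E) (hn : 1 ≤ lam * n) {i j : Fin n}
    (hij : E i j) :
    #{σ ∈ perfectMatchings E | σ i ≠ j} * (lam * n) ≤
      #{σ ∈ perfectMatchings E | σ i = j} * (n : ℝ) ^ 2 := by
  set B : Finset (Perm (Fin n)) := {σ ∈ perfectMatchings E | σ i = j}
  set B' : Finset (Perm (Fin n)) := {σ ∈ perfectMatchings E | σ i ≠ j}
  let rotate : (Σ _ : Perm (Fin n), Fin n) → Perm (Fin n) × Fin n × Fin n := fun x =>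
    (x.1 * (swap i (x.1.symm j) * swap (x.1.symm j) x.2), x.1.symm j, x.2)
  have hmaps : ∀ x ∈ B'.sigma fun σ => rotationRows E σ i (σ.symm j), rotate x ∈ B ×ˢ univ := by
    rintro ⟨σ, c⟩ hx
    obtain ⟨hσ, hc⟩ := mem_sigma.1 hx
    obtain ⟨hσ, hσi⟩ := mem_filter.1 hσ
    refine mem_product.2 ⟨?_, mem_univ _⟩
    simpa [B, rotate] using mul_swap_mul_swap_mem_perfectMatchings hσ (by simpa using hij)
      (fun h => hσi (by simp [h])) hc
  have hinj : rotate.Injective := by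
    rintro ⟨σ, c⟩ ⟨σ', c'⟩ h
    simp only [rotate, Prod.mk.injEq] at h
    obtain ⟨hmul, hsymm, rfl⟩ := h
    rw [hsymm] at hmul
    rw [mul_right_cancel hmul]
  have hcard : ∑ σ ∈ B', #(rotationRows E σ i (σ.symm j)) ≤ #B * n ^ 2 := by
    simpa [sq] using card_le_card_of_injOn rotate hmaps hinj.injOn
  calc #B' * (lam * n) = ∑ _σ ∈ B', lam * n := by rw [sum_const, nsmul_eq_mul]
    _ ≤ ∑ σ ∈ B', (#(rotationRows E σ i (σ.symm j)) : ℝ) :=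
        sum_le_sum fun σ _ => hE.le_card_rotationRows hn σ i _
    _ ≤ #B * (n : ℝ) ^ 2 := by exact_mod_cast hcard

lemma IsDense.le_marginal (hE : IsDense lam E) (hn : 1 ≤ lam * n)
    (hne : (perfectMatchings E).Nonempty) {i j : Fin n} (hij : E i j) :
    lam / 2 / n ≤ marginal E i j := by
  have hn₀ : (1 : ℝ) ≤ n := Nat.one_le_cast.2 i.pos
  have hlam_le : lam ≤ n := by linarith [hE.le_half i.pos]
  have hcount := hE.card_mul_le_card_mul_sq hn hij
  have hsplit : (#{σ ∈ perfectMatchings E | σ i = j} : ℝ) +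
      #{σ ∈ perfectMatchings E | σ i ≠ j} = #(perfectMatchings E) := by
    exact_mod_cast card_filter_add_card_filter_not fun σ : Perm (Fin n) => σ i = j
  have hmarg : marginal E i j =
      #{σ ∈ perfectMatchings E | σ i = j} / #(perfectMatchings E) := rfl
  have hpos : (0 : ℝ) < #(perfectMatchings E) := Nat.cast_pos.2 (card_pos.2 hne)
  rw [hmarg, div_div, div_le_div_iff₀ (by positivity) hpos, ← hsplit]
  set b : ℝ := (#{σ ∈ perfectMatchings E | σ i = j} : ℝ)
  set b' : ℝ := (#{σ ∈ perfectMatchings E | σ i ≠ j} : ℝ)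
  have hb' : b' * lam ≤ b * n := by
    refine le_of_mul_le_mul_right ?_ (zero_lt_one.trans_le hn₀)
    calc b' * lam * n = b' * (lam * n) := mul_assoc _ _ _
      _ ≤ b * (n : ℝ) ^ 2 := hcount
      _ = b * n * n := by ring
  have hb : b * lam ≤ b * n := mul_le_mul_of_nonneg_left hlam_le (Nat.cast_nonneg _)
  linarith

end Graph

/-! ### The entropy bound -/

section EntropyBound

variable {n : ℕ} {E : Fin n → Fin n → Prop} {P Q : Matrix (Fin n) (Fin n) ℝ}

lemma expectedLogTail_eq_expect (Q : Matrix (Fin n) (Fin n) ℝ) (t k : Fin n) :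
    expectedLogTail Q t k = 𝔼 π, Real.log (tailSum (Q t) π k) := by
  rw [Fintype.expect_eq_sum_div_card, Fintype.card_perm, Fintype.card_fin]
  rfl

lemma expectedNegLog_eq_expect (E : Fin n → Fin n → Prop) (Q : Matrix (Fin n) (Fin n) ℝ) :
    expectedNegLog E Q =
      𝔼 σ ∈ perfectMatchings E, 𝔼 π, -Real.log (sisProb E Q π σ) := by
  simp only [expect_eq_sum_div_card, card_univ, Fintype.card_perm, Fintype.card_fin]
  rfl

lemma upperBound_eq_sum_rowBound (h : ∀ t k, P t k ≠ 0 → Q t k ≠ 0) :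
    upperBound P Q = (∑ t, rowBound (P t) (Q t) : ℝ) := by
  simp only [upperBound, if_pos h, rowBound, surprisalBound, expectedLogTail_eq_expect, mul_add,
    mul_neg, sum_add_distrib, sum_neg_distrib]

lemma extendable_subset (E : Fin n → Fin n → Prop) (π σ : Perm (Fin n)) (i : Fin n) :
    extendable E π σ i ⊆ ({j | i ≤ (σ * π)⁻¹ j} : Finset (Fin n)) := by
  intro j hj
  obtain ⟨τ, -, hagree, rfl⟩ : ∃ τ ∈ perfectMatchings E,
      (∀ i' < i, τ (π i') = σ (π i')) ∧ τ (π i) = j := by simpa [extendable] using hj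
  rw [mem_filter_univ]
  by_contra! hlt
  have hvalue : τ (π ((σ * π)⁻¹ (τ (π i)))) = τ (π i) :=
    (hagree _ hlt).trans (by simp)
  exact hlt.ne (π.injective (τ.injective hvalue))

lemma neg_log_sisProb_le (hQ : ∀ i j, 0 ≤ Q i j) {σ : Perm (Fin n)} (hσ : σ ∈ perfectMatchings E)
    (hpos : ∀ i, 0 < Q i (σ i)) (π : Perm (Fin n)) :
    -Real.log (sisProb E Q π σ) ≤
      ∑ t, (-Real.log (Q t (σ t)) + Real.log (tailSum (Q t) (σ * π)⁻¹ (σ t))) := by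
  have hext : ∀ i, 0 < ∑ j ∈ extendable E π σ i, Q (π i) j := fun i =>
    (hpos (π i)).trans_le (single_le_sum (f := Q (π i)) (fun j _ => hQ _ j)
      (by simpa [extendable] using ⟨σ, mem_perfectMatchings.1 hσ, fun _ _ => rfl, rfl⟩))
  have htail : ∀ i, ∑ j ∈ extendable E π σ i, Q (π i) j ≤
      tailSum (Q (π i)) (σ * π)⁻¹ (σ (π i)) := by
    intro i
    refine sum_le_sum_of_subset_of_nonneg ?_ fun j _ _ => hQ _ j
    simpa using extendable_subset E π σ i
  rw [sisProb, Real.log_prod fun i _ => (div_pos (hpos _) (hext i)).ne', ← sum_neg_distrib,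
    ← Equiv.sum_comp π fun t => -Real.log (Q t (σ t)) + _]
  refine sum_le_sum fun i _ => ?_
  rw [Real.log_div (hpos _).ne' (hext i).ne']
  linarith [Real.log_le_log (hext i) (htail i)]

lemma expect_neg_log_sisProb_le (hQ : ∀ i j, 0 ≤ Q i j) {σ : Perm (Fin n)}
    (hσ : σ ∈ perfectMatchings E) (hpos : ∀ i, 0 < Q i (σ i)) :
    𝔼 π, -Real.log (sisProb E Q π σ) ≤ ∑ t, surprisalBound (Q t) (σ t) := by
  have hreparam : ∀ t, 𝔼 π, Real.log (tailSum (Q t) (σ * π)⁻¹ (σ t)) =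
      𝔼 π, Real.log (tailSum (Q t) π (σ t)) := fun t =>
    Fintype.expect_equiv ((Equiv.mulLeft σ).trans (Equiv.inv _)) _ _ fun _ => rfl
  refine (expect_le_expect fun π _ => neg_log_sisProb_le hQ hσ hpos π).trans_eq ?_
  simp only [expect_sum_comm, expect_add_distrib, Fintype.expect_const, hreparam, surprisalBound]

lemma expectedNegLog_le_upperBound (hQ : ∀ i j, 0 ≤ Q i j) :
    (expectedNegLog E Q : EReal) ≤ upperBound (marginal E) Q := by
  by_cases hsupp : ∀ t k, marginal E t k ≠ 0 → Q t k ≠ 0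
  · rw [upperBound_eq_sum_rowBound hsupp, EReal.coe_le_coe_iff, expectedNegLog_eq_expect]
    calc 𝔼 σ ∈ perfectMatchings E, 𝔼 π, -Real.log (sisProb E Q π σ)
        ≤ 𝔼 σ ∈ perfectMatchings E, ∑ t, surprisalBound (Q t) (σ t) :=
          expect_le_expect fun σ hσ => expect_neg_log_sisProb_le hQ hσ fun i =>
            (hQ i (σ i)).lt_of_ne' (hsupp _ _ (marginal_pos hσ i).ne')
      _ = ∑ t, rowBound (marginal E t) (Q t) :=
          expect_perfectMatchings_sum E fun t => surprisalBound (Q t)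
  · rw [upperBound, if_neg hsupp]
    exact le_top

end EntropyBound

/-! ### Convexity along exchanges -/

section ExtendedReal

variable {D S : Set ℝ} {f : ℝ → ℝ} {g : ℝ → EReal}

lemma ConvexOnEReal.of_convexOn (hf : ConvexOn ℝ D f) (hD : ∀ x ∈ D, g x = f x)
    (hS : ∀ x ∈ S \ D, g x = ⊤) : ConvexOnEReal S g := by
  have hcase : ∀ z ∈ S, g z = ⊤ ∨ z ∈ D := fun z hz =>
    or_iff_not_imp_right.2 fun hzD => hS z ⟨hz, hzD⟩
  have hbot : ∀ z ∈ S, ∀ c : ℝ, 0 < c → (c : EReal) * g z ≠ ⊥ := by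
    intro z hz c hc
    rcases hcase z hz with h | h
    · simp [h, EReal.coe_mul_top_of_pos hc]
    · rw [hD z h, ← EReal.coe_mul]
      exact EReal.coe_ne_bot _
  intro x hx y hy θ hθ hθ'
  rcases hθ.eq_or_lt with rfl | hθ₀
  · simp
  rcases hθ'.eq_or_lt with rfl | hθ₁
  · simp
  have hθ₂ : 0 < 1 - θ := sub_pos.2 hθ₁
  rcases hcase x hx with hx' | hxD
  · rw [hx', EReal.coe_mul_top_of_pos hθ₀, EReal.top_add_of_ne_bot (hbot y hy _ hθ₂)]
    exact le_top
  rcases hcase y hy with hy' | hyD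
  · rw [hy', EReal.coe_mul_top_of_pos hθ₂, EReal.add_top_of_ne_bot (hbot x hx _ hθ₀)]
    exact le_top
  have hmem := hf.1 hxD hyD hθ hθ₂.le (add_sub_cancel _ _)
  have hconv := hf.2 hxD hyD hθ hθ₂.le (add_sub_cancel _ _)
  simp only [smul_eq_mul] at hmem hconv
  rw [hD x hxD, hD y hyD, hD _ hmem]
  exact_mod_cast hconv

lemma ConvexOnEReal.le_max (hg : ConvexOnEReal S g) {u v z : ℝ} (hu : u ∈ S) (hv : v ∈ S)
    (huz : u ≤ z) (hzv : z ≤ v) : g z ≤ max (g u) (g v) := by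
  obtain ⟨θ, θ', hθ, hθ', hsum, rfl⟩ : z ∈ segment ℝ u v := by
    rw [segment_eq_Icc (huz.trans hzv)]
    exact ⟨huz, hzv⟩
  obtain rfl : θ' = 1 - θ := eq_sub_of_add_eq' hsum
  have hθ₀ : (0 : EReal) ≤ θ := EReal.coe_nonneg.2 hθ
  have hθ₁ : (0 : EReal) ≤ (1 - θ : ℝ) := EReal.coe_nonneg.2 hθ'
  calc g (θ * u + (1 - θ) * v) ≤ θ * g u + (1 - θ : ℝ) * g v :=
        hg u hu v hv θ hθ (sub_nonneg.1 hθ')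
    _ ≤ θ * max (g u) (g v) + (1 - θ : ℝ) * max (g u) (g v) :=
        add_le_add (mul_le_mul_of_nonneg_left (le_max_left _ _) hθ₀)
          (mul_le_mul_of_nonneg_left (le_max_right _ _) hθ₁)
    _ = max (g u) (g v) := by
        rw [← EReal.right_distrib_of_nonneg hθ₀ hθ₁, ← EReal.coe_add, hsum, EReal.coe_one, one_mul]

end ExtendedReal

section Exchange

variable {n : ℕ} {P Q : Matrix (Fin n) (Fin n) ℝ} {i j₁ j₂ : Fin n}

lemma exchange_eq_updateRow (hj : j₁ ≠ j₂) (x : ℝ) :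
    exchange Q i j₁ j₂ x = Q.updateRow i (transfer (Q i) j₁ j₂ x) := by
  ext t k
  rw [exchange, Matrix.of_apply, Matrix.updateRow_apply]
  rcases eq_or_ne t i with rfl | ht
  · rcases eq_or_ne k j₁ with rfl | h₁
    · simp [hj]
    rcases eq_or_ne k j₂ with rfl | h₂
    · simp [hj, h₁]
    · simp [h₁, h₂, transfer_apply_of_ne]
  · simp [ht]

lemma exchange_self (hj : j₁ ≠ j₂) : exchange Q i j₁ j₂ (Q i j₁) = Q := by
  rw [exchange_eq_updateRow hj, transfer_self, Matrix.updateRow_eq_self]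

lemma forall_exchange_apply_ne_zero_iff (hj : j₁ ≠ j₂) (h₁ : P i j₁ ≠ 0) (h₂ : P i j₂ ≠ 0)
    (x : ℝ) :
    (∀ t k, P t k ≠ 0 → exchange Q i j₁ j₂ x t k ≠ 0) ↔
      (x ≠ 0 ∧ x ≠ Q i j₁ + Q i j₂) ∧
        ∀ t k, P t k ≠ 0 → ¬(t = i ∧ (k = j₁ ∨ k = j₂)) → Q t k ≠ 0 := by
  have hleft : exchange Q i j₁ j₂ x i j₁ = x := by simp [exchange]
  have hright : exchange Q i j₁ j₂ x i j₂ = Q i j₁ + Q i j₂ - x := by simp [exchange, hj.symm]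
  have hrest : ∀ t k, ¬(t = i ∧ (k = j₁ ∨ k = j₂)) → exchange Q i j₁ j₂ x t k = Q t k := by
    intro t k htk
    rw [and_or_left, not_or] at htk
    simp [exchange, htk.1, htk.2]
  constructor
  · intro h
    refine ⟨⟨hleft ▸ h i j₁ h₁, fun hx => h i j₂ h₂ (by rw [hright, hx, sub_self])⟩, ?_⟩
    exact fun t k hP htk => hrest t k htk ▸ h t k hP
  · rintro ⟨⟨hx₀, hx⟩, h⟩ t k hP
    by_cases htk : t = i ∧ (k = j₁ ∨ k = j₂)
    · obtain ⟨rfl, rfl | rfl⟩ := htk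
      · rwa [hleft]
      · rw [hright]
        exact sub_ne_zero.2 hx.symm
    · rw [hrest t k htk]
      exact h t k hP htk

lemma convexOn_sum_rowBound_exchange {D : Set ℝ} (hj : j₁ ≠ j₂)
    (h : ConvexOn ℝ D fun x => rowBound (P i) (transfer (Q i) j₁ j₂ x)) :
    ConvexOn ℝ D fun x => ∑ t, rowBound (P t) (exchange Q i j₁ j₂ x t) := by
  refine convexOn_sum h.1 fun t _ => ?_
  simp only [exchange_eq_updateRow hj]
  rcases eq_or_ne t i with rfl | ht
  · simpa [Matrix.updateRow_self] using h
  · simpa [Matrix.updateRow_ne ht] using convexOn_const _ h.1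

lemma convexOnEReal_upperBound_exchange (hj : j₁ ≠ j₂) (h₁ : P i j₁ ≠ 0) (h₂ : P i j₂ ≠ 0)
    (h : ConvexOn ℝ (Set.Ioo 0 (Q i j₁ + Q i j₂)) fun x =>
      rowBound (P i) (transfer (Q i) j₁ j₂ x)) :
    ConvexOnEReal (Set.Icc 0 (Q i j₁ + Q i j₂)) fun x =>
      upperBound P (exchange Q i j₁ j₂ x) := by
  have hiff := forall_exchange_apply_ne_zero_iff (Q := Q) hj h₁ h₂
  have htop : ∀ x, ¬(∀ t k, P t k ≠ 0 → exchange Q i j₁ j₂ x t k ≠ 0) →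
      upperBound P (exchange Q i j₁ j₂ x) = ⊤ := fun x hx => if_neg hx
  by_cases hsupp : ∀ t k, P t k ≠ 0 → ¬(t = i ∧ (k = j₁ ∨ k = j₂)) → Q t k ≠ 0
  · refine .of_convexOn (convexOn_sum_rowBound_exchange hj h) (fun x hx => ?_) fun x hx => ?_
    · exact upperBound_eq_sum_rowBound ((hiff x).2 ⟨⟨hx.1.ne', hx.2.ne⟩, hsupp⟩)
    · refine htop x fun hall => hx.2 ?_
      obtain ⟨⟨hx₀, hxs⟩, -⟩ := (hiff x).1 hall
      exact ⟨hx.1.1.lt_of_ne' hx₀, hx.1.2.lt_of_ne hxs⟩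
  · exact .of_convexOn (D := ∅) (f := 0) ⟨convex_empty, by simp⟩ (by simp)
      fun x _ => htop x fun hall => hsupp ((hiff x).1 hall).2

end Exchange

/-! ### Extremal matrices -/

section Extremal

variable {n : ℕ} {QA Q : Matrix (Fin n) (Fin n) ℝ} {i j₁ j₂ : Fin n} {x : ℝ}

lemma rowMax_div (QA : Matrix (Fin n) (Fin n) ℝ) (i : Fin n) :
    rowMax QA i / n = ⨆ j, QA i j :=
  mul_div_cancel_left₀ _ (Nat.cast_ne_zero.2 i.pos.ne')

lemma mem_classQ_iff : Q ∈ classQ QA ↔ (∀ i j, 0 ≤ Q i j) ∧ (∀ i, ∑ j, Q i j = 1) ∧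
    (∀ i j, Q i j ≤ rowMax QA i / n) ∧ ∀ i j, 0 < Q i j → 0 < QA i j := by
  simp only [classQ, Set.mem_ofPred_eq, Matrix.mem_rowStochastic_iff_sum, and_assoc]

lemma mem_classQ_self (h : QA ∈ Matrix.rowStochastic ℝ (Fin n)) : QA ∈ classQ QA := by
  refine ⟨h, fun i j => ?_, fun _ _ => id⟩
  rw [rowMax_div]
  exact le_ciSup (f := QA i) (Set.finite_range _).bddAbove j

lemma exchange_mem_classQ (hQ : Q ∈ classQ QA) (hj : j₁ ≠ j₂) (h₁ : 0 < Q i j₁)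
    (h₂ : 0 < Q i j₂) (hx : x ∈ Set.Icc (max 0 (Q i j₁ + Q i j₂ - rowMax QA i / n))
      (min (Q i j₁ + Q i j₂) (rowMax QA i / n))) : exchange Q i j₁ j₂ x ∈ classQ QA := by
  obtain ⟨⟨hx₀, hx_lower⟩, hx_sum, hx_upper⟩ := hx.imp max_le_iff.1 le_min_iff.1
  obtain ⟨hnonneg, hsum, hle, hpos⟩ := mem_classQ_iff.1 hQ
  have hrow : ∀ t, ∑ k, exchange Q i j₁ j₂ x t k = 1 := by
    intro t
    rw [← hsum t, exchange_eq_updateRow hj]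
    rcases eq_or_ne t i with rfl | ht
    · rw [Matrix.updateRow_self, sum_transfer]
    · rw [Matrix.updateRow_ne ht]
  have hentry : ∀ t k, 0 ≤ exchange Q i j₁ j₂ x t k ∧
      exchange Q i j₁ j₂ x t k ≤ rowMax QA t / n ∧
      (0 < exchange Q i j₁ j₂ x t k → 0 < QA t k) := by
    intro t k
    rw [exchange, Matrix.of_apply]
    split_ifs with hleft hright
    · obtain ⟨rfl, rfl⟩ := hleft
      exact ⟨hx₀, hx_upper, fun _ => hpos _ _ h₁⟩
    · obtain ⟨rfl, rfl⟩ := hright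
      exact ⟨sub_nonneg.2 hx_sum, sub_le_comm.1 hx_lower, fun _ => hpos _ _ h₂⟩
    · exact ⟨hnonneg t k, hle t k, hpos t k⟩
  exact mem_classQ_iff.2 ⟨fun t k => (hentry t k).1, hrow, fun t k => (hentry t k).2.1,
    fun t k => (hentry t k).2.2⟩

open scoped Classical in
/-- The positions of the entries of `Q` that are neither zero nor equal to the bound `r_i / n` of
their row in the class `𝒬`. -/
noncomputable def fractional (QA Q : Matrix (Fin n) (Fin n) ℝ) : Finset (Fin n × Fin n) :=
  {e | Q e.1 e.2 ≠ 0 ∧ Q e.1 e.2 ≠ rowMax QA e.1 / n}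

lemma mem_fractional {t k : Fin n} :
    (t, k) ∈ fractional QA Q ↔ Q t k ≠ 0 ∧ Q t k ≠ rowMax QA t / n := by
  simp [fractional]

lemma card_fractional_exchange_lt (h₁ : (i, j₁) ∈ fractional QA Q)
    (h₂ : (i, j₂) ∈ fractional QA Q)
    (hx : (i, j₁) ∉ fractional QA (exchange Q i j₁ j₂ x) ∨
      (i, j₂) ∉ fractional QA (exchange Q i j₁ j₂ x)) :
    #(fractional QA (exchange Q i j₁ j₂ x)) < #(fractional QA Q) := by
  have hsub : fractional QA (exchange Q i j₁ j₂ x) ⊆ fractional QA Q := by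
    rintro ⟨t, k⟩ htk
    by_cases hleft : t = i ∧ k = j₁
    · rwa [hleft.1, hleft.2]
    by_cases hright : t = i ∧ k = j₂
    · rwa [hright.1, hright.2]
    simpa [mem_fractional, exchange, hleft, hright] using htk
  refine card_lt_card ⟨hsub, fun hsup => ?_⟩
  exact hx.elim (fun h => h (hsup h₁)) fun h => h (hsup h₂)

lemma exists_exchange_card_fractional_lt {F : Matrix (Fin n) (Fin n) ℝ → EReal}
    (hQ : Q ∈ classQ QA) (hj : j₁ ≠ j₂)
    (hF : ConvexOnEReal (Set.Icc 0 (Q i j₁ + Q i j₂)) fun x => F (exchange Q i j₁ j₂ x))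
    (h₁ : (i, j₁) ∈ fractional QA Q) (h₂ : (i, j₂) ∈ fractional QA Q) :
    ∃ Q' ∈ classQ QA, F Q ≤ F Q' ∧ #(fractional QA Q') < #(fractional QA Q) := by
  obtain ⟨hnonneg, -, hle, -⟩ := mem_classQ_iff.1 hQ
  have hpos₁ : 0 < Q i j₁ := (hnonneg _ _).lt_of_ne' (mem_fractional.1 h₁).1
  have hpos₂ : 0 < Q i j₂ := (hnonneg _ _).lt_of_ne' (mem_fractional.1 h₂).1
  set s := Q i j₁ + Q i j₂ with hs
  set ρ := rowMax QA i / n with hρ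
  have hmem : ∀ x ∈ Set.Icc (max 0 (s - ρ)) (min s ρ), exchange Q i j₁ j₂ x ∈ classQ QA :=
    fun x hx => exchange_mem_classQ hQ hj hpos₁ hpos₂ hx
  have hleft : ∀ x, (i, j₁) ∈ fractional QA (exchange Q i j₁ j₂ x) ↔ x ≠ 0 ∧ x ≠ ρ := by
    simp [mem_fractional, exchange, hρ]
  have hright : ∀ x, (i, j₂) ∈ fractional QA (exchange Q i j₁ j₂ x) ↔
      s - x ≠ 0 ∧ s - x ≠ ρ := by
    simp [mem_fractional, exchange, hj.symm, hρ, hs]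
  have hu : max 0 (s - ρ) ≤ Q i j₁ := max_le hpos₁.le (by linarith [hle i j₂])
  have hv : Q i j₁ ≤ min s ρ := le_min (by linarith) (hle i j₁)
  have hmax := hF.le_max ⟨le_max_left _ _, hu.trans (by linarith)⟩
    ⟨hpos₁.le.trans hv, min_le_left _ _⟩ hu hv
  simp only [exchange_self hj] at hmax
  rcases le_max_iff.1 hmax with h | h
  · refine ⟨_, hmem _ ⟨le_rfl, hu.trans hv⟩, h, card_fractional_exchange_lt h₁ h₂ ?_⟩
    rw [hleft, hright]
    rcases max_choice 0 (s - ρ) with hchoice | hchoice <;> simp [hchoice]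
  · refine ⟨_, hmem _ ⟨hu.trans hv, le_rfl⟩, h, card_fractional_exchange_lt h₁ h₂ ?_⟩
    rw [hleft, hright]
    rcases min_choice s ρ with hchoice | hchoice <;> simp [hchoice]

lemma exists_extremal_ge {F : Matrix (Fin n) (Fin n) ℝ → EReal}
    (hF : ∀ Q ∈ classQ QA, ∀ i j₁ j₂, j₁ ≠ j₂ → 0 < QA i j₁ → 0 < QA i j₂ →
      ConvexOnEReal (Set.Icc 0 (Q i j₁ + Q i j₂)) fun x => F (exchange Q i j₁ j₂ x))
    (hQ : Q ∈ classQ QA) :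
    ∃ Qs ∈ classQ QA, (∀ i, {j | Qs i j ≠ 0 ∧ Qs i j ≠ rowMax QA i / n}.Subsingleton) ∧
      F Q ≤ F Qs := by
  obtain ⟨Qs, ⟨hQs, hFQs⟩, hmin⟩ := exists_minimalFor_of_wellFoundedLT
    (fun Q' => Q' ∈ classQ QA ∧ F Q ≤ F Q') (fun Q' => #(fractional QA Q')) ⟨Q, hQ, le_rfl⟩
  refine ⟨Qs, hQs, fun i j₁ h₁ j₂ h₂ => ?_, hFQs⟩
  by_contra hj
  obtain ⟨hnonneg, -, -, hpos⟩ := mem_classQ_iff.1 hQs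
  obtain ⟨Q', hQ', hle, hlt⟩ := exists_exchange_card_fractional_lt hQs hj
    (hF Qs hQs i j₁ j₂ hj (hpos _ _ ((hnonneg _ _).lt_of_ne' h₁.1))
      (hpos _ _ ((hnonneg _ _).lt_of_ne' h₂.1)))
    (mem_fractional.2 h₁) (mem_fractional.2 h₂)
  exact hlt.not_ge (hmin ⟨hQ', hFQs.trans hle⟩ hlt.le)

end Extremal

lemma eventually_convexOnEReal_upperBound_marginal {lam : ℝ} (hlam : 0 < lam)
    (hlam' : lam < 1 / 2) :
    ∀ᶠ n : ℕ in Filter.atTop, ∀ E : Fin n → Fin n → Prop, IsDense lam E →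
      ∀ QA : Matrix (Fin n) (Fin n) ℝ, IsScaling (adjMatrix E) QA →
        ∀ Q ∈ classQ QA, ∀ i j₁ j₂ : Fin n, j₁ ≠ j₂ → E i j₁ → E i j₂ →
          ConvexOnEReal (Set.Icc 0 (Q i j₁ + Q i j₂)) fun x =>
            upperBound (marginal E) (exchange Q i j₁ j₂ x) := by
  have hC : 1 ≤ 1 / (2 * lam) := (one_le_div (by positivity)).2 (by linarith)
  filter_upwards [eventually_convexOn_rowBound_transfer hC (half_pos hlam),
    (tendsto_natCast_atTop_atTop.const_mul_atTop hlam).eventually_ge_atTop 1] with n hrow hn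
  intro E hE QA hQA Q hQ i j₁ j₂ hj h₁ h₂
  have hne := hQA.perfectMatchings_nonempty
  obtain ⟨hnonneg, hsum, hle, -⟩ := mem_classQ_iff.1 hQ
  have hmarg : ∀ {j}, E i j → lam / 2 / n ≤ marginal E i j := hE.le_marginal hn hne
  have hpos : 0 < lam / 2 / n := div_pos (half_pos hlam) (Nat.cast_pos.2 i.pos)
  have hbound : ∀ j, Q i j ≤ 1 / (2 * lam) / n := by
    intro j
    have : Nonempty (Fin n) := ⟨i⟩
    refine (hle i j).trans ?_
    rw [rowMax_div]
    exact ciSup_le (hQA.apply_le hE hlam i)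
  exact convexOnEReal_upperBound_exchange hj (hpos.trans_le (hmarg h₁)).ne'
    (hpos.trans_le (hmarg h₂)).ne' (hrow (marginal E i) (Q i) (marginal_nonneg E i)
      (sum_marginal hne i) (hnonneg i) (hsum i) hbound j₁ j₂ hj (hmarg h₁) (hmarg h₂))

end SIS

theorem mainTheorem4 (lam : ℝ) (hlam : 0 < lam) (hlam' : lam < 1 / 2) :
    ∃ N : ℕ, ∀ n : ℕ, N ≤ n → ∀ E : Fin n → Fin n → Prop, SIS.IsDense lam E →
      ∀ QA : Matrix (Fin n) (Fin n) ℝ, SIS.IsScaling (SIS.adjMatrix E) QA →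
        (∃ Qs ∈ SIS.classQ QA,
          (∀ i, {j | Qs i j ≠ 0 ∧ Qs i j ≠ SIS.rowMax QA i / (n : ℝ)}.Subsingleton) ∧
          (SIS.expectedNegLog E QA : EReal) ≤ SIS.upperBound (SIS.marginal E) Qs) ∧
        (∀ Q ∈ SIS.classQ QA, ∀ i j₁ j₂ : Fin n, j₁ ≠ j₂ → E i j₁ → E i j₂ →
          SIS.ConvexOnEReal (Set.Icc 0 (Q i j₁ + Q i j₂))
            (fun x => SIS.upperBound (SIS.marginal E) (SIS.exchange Q i j₁ j₂ x))) := by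
  obtain ⟨N, hN⟩ := Filter.eventually_atTop.1
    (SIS.eventually_convexOnEReal_upperBound_marginal hlam hlam')
  refine ⟨N, fun n hn E hE QA hQA => ?_⟩
  have hconv := hN n hn E hE QA hQA
  have hmem : QA ∈ SIS.classQ QA :=
    SIS.mem_classQ_self (Matrix.mem_rowStochastic_iff_sum.2
      ⟨hQA.apply_nonneg, sum_row_of_mem_doublyStochastic hQA.1⟩)
  obtain ⟨Qs, hQs, hextremal, hle⟩ := SIS.exists_extremal_ge
    (F := SIS.upperBound (SIS.marginal E)) (fun Q hQ i j₁ j₂ hj h₁ h₂ =>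
      hconv Q hQ i j₁ j₂ hj (hQA.edge_of_apply_pos h₁) (hQA.edge_of_apply_pos h₂)) hmem
  exact ⟨⟨Qs, hQs, hextremal,
    (SIS.expectedNegLog_le_upperBound hQA.apply_nonneg).trans hle⟩, hconv⟩
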